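/- All spaces are regular and $T_1$. A family $\mathcal{U}$ of subsets of a space $X$ is closure-preserving (CP) if $\overline{\bigcup\mathcal{V}}=\bigcup\{\overline{V}\mid V\in\mathcal{V}\}$ for every $\mathcal{V}\subset\mathcal{U}$. A space $X$ is an $M_3$-space if there is a collection $\mathcal{Q}=\bigcup_{n\in\mathbb{N}}\mathcal{Q}_n$ of ordered pairs $(P_1,P_2)$ of subsets of $X$ with $P_1\subset P_2$ and $P_1$ open, such that for each open $U$ and each $x\in U$ there is $(P_1,P_2)\in\mathcal{Q}$ with $x\in P_1\subset P_2\subset U$, and such that $\overline{\bigcup\{P_1\mid (P_1,P_2)\in\mathcal{Q}'\}}\subset\bigcup\{P_2\mid (P_1,P_2)\in\mathcal{Q}'\}$ for every $n$ and every $\mathcal{Q}'\subset\mathcal{Q}_n$. Let $\mathcal{P}$ be the class of all $M_3$-spaces in which every closed subset $F$ has a CP open neighborhood base, i.e. a CP family $\mathcal{U}$ of open sets containing $F$ such that every open $O\supset F$ contains some $U\in\mathcal{U}$. A space $X$ satisfies property $(\delta)$ if for each closed nowhere dense $M\subset X$ and each $p\in M$ there is a CP family $\mathcal{B}$ of closed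 subsets of $X$ which is a local network at $p$ (every $B\in\mathcal{B}$ contains $p$, and every open set containing $p$ contains some $B\in\mathcal{B}$) and satisfies $B=\overline{B\setminus M}$ for each $B\in\mathcal{B}$. For $A\subset X$ put $[A]=\{p\in X\mid \text{there is } B\subset A \text{ with } \overline{B}=B\cup\{p\}\}$, $A_0=A$, $A_{\alpha+1}=[A_\alpha]$, and $A_\alpha=\bigcup_{\beta<\alpha}A_\beta$ for limit ordinals $\alpha$. The $\delta$-order $\delta(X)$ is the least ordinal $\alpha$ such that $\overline{A}=A_\alpha$ for all $A\subset X$, if such an ordinal exists; in that case $X$ is said to have the $\delta$-order. Theorem. If an $M_3$-space $X$ has the $\delta$-order, then $X$ satisfies property $(\delta)$, and consequently $X\in\mathcal{P}$. In particular, every sequential $M_3$-space satisfies property $(\delta)$ and belongs to $\mathcal{P}$. -/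

import Mathlib

universe u

namespace M3Problem

/-- A family of subsets is closure-preserving (CP) if the closure of the union of any subfamily
is the union of the closures of its members. -/
def ClosurePreserving {X : Type u} [TopologicalSpace X] (𝒰 : Set (Set X)) : Prop :=
  ∀ 𝒱 ⊆ 𝒰, closure (⋃ V ∈ 𝒱, V) = ⋃ V ∈ 𝒱, closure V

/-- A family of ordered pairs `(P₁, P₂)` of subsets is cushioned if for every subfamily the closure
of the union of the first members lies in the union of the second members. -/
def Cushioned {X : Type u} [TopologicalSpace X] (𝒬 : Set (Set X × Set X)) : Prop :=
  ∀ 𝒮 ⊆ 𝒬, closure (⋃ P ∈ 𝒮, P.1) ⊆ ⋃ P ∈ 𝒮, P.2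

/-- A pair-base: pairs `P₁ ⊆ P₂` with `P₁` open, such that whenever `x` lies in an open set `U`,
some pair of the family satisfies `x ∈ P₁ ⊆ P₂ ⊆ U`. -/
structure IsPairBase {X : Type u} [TopologicalSpace X] (𝒬 : Set (Set X × Set X)) : Prop where
  isOpen_fst : ∀ P ∈ 𝒬, IsOpen P.1
  fst_subset_snd : ∀ P ∈ 𝒬, P.1 ⊆ P.2
  exists_mem : ∀ (x : X) (U : Set X), IsOpen U → x ∈ U → ∃ P ∈ 𝒬, x ∈ P.1 ∧ P.2 ⊆ U

/-- `M₃`-space: a space with a `σ`-cushioned pair-base. (The separation axioms `T₁` and regular,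
which are part of the notion of a space here, are assumed separately.) -/
def IsM3Space (X : Type u) [TopologicalSpace X] : Prop :=
  ∃ 𝒬 : ℕ → Set (Set X × Set X), (∀ n, Cushioned (𝒬 n)) ∧ IsPairBase (⋃ n, 𝒬 n)

/-- `𝒰` is an open neighborhood base of the set `F`. -/
structure IsOpenNhdBase {X : Type u} [TopologicalSpace X] (F : Set X) (𝒰 : Set (Set X)) :
    Prop where
  isOpen : ∀ U ∈ 𝒰, IsOpen U
  subset : ∀ U ∈ 𝒰, F ⊆ U
  exists_subset : ∀ O : Set X, IsOpen O → F ⊆ O → ∃ U ∈ 𝒰, U ⊆ O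

/-- The class `𝒫` of `M₃`-spaces each closed subset of which has a CP open neighborhood base. -/
def InClassP (X : Type u) [TopologicalSpace X] : Prop :=
  IsM3Space X ∧
    ∀ F : Set X, IsClosed F → ∃ 𝒰 : Set (Set X), IsOpenNhdBase F 𝒰 ∧ ClosurePreserving 𝒰

/-- `ℬ` is a local network at the point `p`. -/
structure IsLocalNetwork {X : Type u} [TopologicalSpace X] (p : X) (ℬ : Set (Set X)) : Prop where
  mem : ∀ B ∈ ℬ, p ∈ B
  exists_subset : ∀ U : Set X, IsOpen U → p ∈ U → ∃ B ∈ ℬ, B ⊆ U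

/-- Property `(δ)`. -/
def PropertyDelta (X : Type u) [TopologicalSpace X] : Prop :=
  ∀ M : Set X, IsClosed M → IsNowhereDense M → ∀ p ∈ M,
    ∃ ℬ : Set (Set X), (∀ B ∈ ℬ, IsClosed B) ∧ ClosurePreserving ℬ ∧ IsLocalNetwork p ℬ ∧
      ∀ B ∈ ℬ, B = closure (B \ M)

/-- The operator `[A]`: all points `p` such that `closure B = B ∪ {p}` for some `B ⊆ A`. -/
def deltaHull {X : Type u} [TopologicalSpace X] (A : Set X) : Set X :=
  {p | ∃ B ⊆ A, closure B = B ∪ {p}}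

/-- The transfinite iterates `A_α` of the operator `[·]`, starting from `A₀ = A`. -/
noncomputable def deltaIter {X : Type u} [TopologicalSpace X] (A : Set X) (α : Ordinal.{u}) :
    Set X :=
  Ordinal.limitRecOn (motive := fun _ => Set X) α A
    (fun _ S => deltaHull S) (fun α _ S => ⋃ (β : Ordinal.{u}) (h : β < α), S β h)

theorem deltaIter_zero {X : Type u} [TopologicalSpace X] (A : Set X) : deltaIter A 0 = A := by
  simp [deltaIter]

theorem deltaIter_succ {X : Type u} [TopologicalSpace X] (A : Set X) (α : Ordinal.{u}) :
    deltaIter A (Order.succ α) = deltaHull (deltaIter A α) := by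
  simp [deltaIter]

theorem deltaIter_limit {X : Type u} [TopologicalSpace X] (A : Set X) (α : Ordinal.{u})
    (hα : Order.IsSuccLimit α) : deltaIter A α = ⋃ β < α, deltaIter A β := by
  simp only [deltaIter]
  rw [Ordinal.limitRecOn_limit _ _ _ _ hα]

/-- `α` is the `δ`-order of `X`: the least ordinal such that `closure A = A_α` for all `A`. -/
def IsDeltaOrder (X : Type u) [TopologicalSpace X] (α : Ordinal.{u}) : Prop :=
  IsLeast {β : Ordinal.{u} | ∀ A : Set X, closure A = deltaIter A β} α

/-- `X` has the `δ`-order, that is, its `δ`-order is defined. -/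
def HasDeltaOrder (X : Type u) [TopologicalSpace X] : Prop :=
  ∃ α : Ordinal.{u}, IsDeltaOrder X α

end M3Problem

/-! Call a point good for a class `𝒞` of closed sets if it has a CP local network of members of `𝒞`,
and suppose that `𝒞` contains the closure of the union of each of its subfamilies. The core is that
goodness passes from `A` to `deltaHull A`. If `closure B = B ∪ {p}` with `p ∉ B`, trace a CP base of
closed neighbourhoods of `p` on `B ∪ {p}`, and attach to each trace small network members at a dense
set of its points in `B`. If the attaching points are σ-discrete off `p` and the attached sets
shrink suitably, closure preservation survives (`exists_fattening`), and each new set is the closure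
of the union of the attached sets, hence in `𝒞`. By transfinite induction, in a space with the
δ-order a dense set of good points makes all points good.

For property (δ), let `𝒞` be the sets with `B = closure (B \ M)`; each point off `M` is good through
its singleton.

For `𝒫`, let `𝒞` be the regular closed sets. Points of countable character are good, and the others
lie in an increasing union of closed nowhere dense sets `M n`. Were the good points not dense, some
nonempty open `U` without good points would lie in `⋃ n, M n`. Starting from `{p}` with `p ∈ U`, one
enlarges the sets to be regular closed at the points of `M 1`, `M 2`, ..., using (δ) networks and
then closed neighbourhoods. Additions after stage `n` stay in transitive neighbourhoods shrinking
towards `M n`, so the unions are still CP and `p` is good, a contradiction. So every point is good;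
attaching regular closed sets to a CP closed neighbourhood base of `F` makes it regular closed, and
interiors of its members form the required base. -/

namespace M3Problem

open Set Filter Topology

/-! ### Stratifications, discrete kernels and expansions -/

/-- A stratification, given by a decreasing sequence of open neighbourhood assignments. -/
structure Stratification {X : Type u} [TopologicalSpace X] (g : ℕ → X → Set X) : Prop where
  isOpen : ∀ n x, IsOpen (g n x)
  mem : ∀ n x, x ∈ g n x
  anti : ∀ x, Antitone fun n => g n x
  sep : ∀ F : Set X, IsClosed F → ∀ y ∉ F, ∃ n, y ∉ closure (⋃ x ∈ F, g n x)

/-- From `x`, remove the closures of the unions of those `P.1` with `x ∉ P.2`, over the first `n +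
1` families; cushioning keeps `x` itself. A pair with `y ∈ P.1` and `P.2 ⊆ Fᶜ` then witnesses
separation of `y` from `F`. -/
theorem IsM3Space.exists_stratification {X : Type u} [TopologicalSpace X] (h : IsM3Space X) :
    ∃ g : ℕ → X → Set X, Stratification g := by
  obtain ⟨Q, hQ, hB⟩ := h
  refine ⟨fun n x => ⋂ m ∈ Finset.range (n + 1),
    (closure (⋃ P ∈ {P ∈ Q m | x ∉ P.2}, P.1))ᶜ, ?_, ?_, ?_, ?_⟩
  · intro n x
    exact isOpen_biInter_finset fun m _ => isClosed_closure.isOpen_compl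
  · intro n x
    simp only [mem_iInter]
    intro m _ hx
    have := hQ m {P ∈ Q m | x ∉ P.2} (sep_subset _ _) hx
    simp only [mem_iUnion] at this
    obtain ⟨P, hP, hxP⟩ := this
    exact hP.2 hxP
  · intro x n m hnm
    refine biInter_subset_biInter_left fun k hk => ?_
    simp only [SetLike.mem_coe, Finset.mem_range] at hk ⊢
    omega
  · intro F hF y hy
    obtain ⟨P, hP, hyP, hPF⟩ := hB.exists_mem y Fᶜ hF.isOpen_compl hy
    obtain ⟨n, hn⟩ := mem_iUnion.1 hP
    refine ⟨n, fun hcl => ?_⟩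
    obtain ⟨z, hz, hz'⟩ := mem_closure_iff.1 hcl P.1 (hB.isOpen_fst P hP) hyP
    simp only [mem_iUnion] at hz'
    obtain ⟨x, hx, hzx⟩ := hz'
    have := mem_iInter₂.1 hzx n (by simp)
    refine this (subset_closure ?_)
    simp only [mem_iUnion]
    exact ⟨P, ⟨hn, fun h => hPF h hx⟩, hz⟩

section

variable {X : Type u} [TopologicalSpace X] {g : ℕ → X → Set X}

theorem Stratification.sep' (hg : Stratification g) {F : Set X} (hF : IsClosed F) {y : X}
    (hy : y ∉ F) : ∃ n, ∀ x ∈ F, y ∉ g n x := by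
  obtain ⟨n, hn⟩ := hg.sep F hF y hy
  exact ⟨n, fun x hx h => hn (subset_closure (mem_biUnion hx h))⟩

/-- Neighbourhoods of the points off a closed set `M` which shrink towards `M`. -/
theorem Stratification.exists_shrinking (hg : Stratification g) {M : Set X} (hM : IsClosed M) :
    ∃ Ω : X → Set X, (∀ x, IsOpen (Ω x)) ∧ (∀ x ∉ M, x ∈ Ω x) ∧ (∀ x, Disjoint (Ω x) M) ∧
      ∀ S, IsClosed S → ∀ z ∈ M, z ∉ S → ∃ P, IsOpen P ∧ z ∈ P ∧ ∀ x ∈ S, Disjoint P (Ω x) := by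
  have : ∀ x, ∃ n, x ∉ M → x ∉ closure (⋃ y ∈ M, g n y) := fun x => by
    by_cases hx : x ∈ M
    · exact ⟨0, fun h => (h hx).elim⟩
    · obtain ⟨n, hn⟩ := hg.sep M hM x hx
      exact ⟨n, fun _ => hn⟩
  choose n hn using this
  refine ⟨fun x => g (n x) x \ closure (⋃ y ∈ M, g (n x) y), fun x => (hg.isOpen _ _).sdiff
    isClosed_closure, fun x hx => ⟨hg.mem _ _, hn x hx⟩, fun x => ?_, fun S hS z hz hzS => ?_⟩
  · rw [Set.disjoint_left]
    exact fun y hy hyM => hy.2 (subset_closure (mem_biUnion hyM (hg.mem _ _)))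
  · obtain ⟨m, hm⟩ := hg.sep S hS z hzS
    refine ⟨g m z \ closure (⋃ y ∈ S, g m y), (hg.isOpen _ _).sdiff isClosed_closure,
      ⟨hg.mem _ _, hm⟩, fun x hx => ?_⟩
    rw [Set.disjoint_left]
    intro w hw hw'
    rcases le_total m (n x) with h | h
    · exact hw.2 (subset_closure (mem_biUnion hx (hg.anti x h hw'.1)))
    · exact hw'.2 (subset_closure (mem_biUnion hz (hg.anti z h hw.1)))

/-- Every neighbourhood assignment off a closed set `M` covers `Mᶜ` already along a subset of `Mᶜ`
which is closed and discrete in `Mᶜ`. -/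
theorem Stratification.exists_discrete_kernel (hg : Stratification g) {M : Set X}
    (hM : IsClosed M) {V : X → Set X} (hVo : ∀ x, IsOpen (V x)) (hV : ∀ x, x ∈ V x) :
    ∃ E : Set X, Disjoint E M ∧ (∀ z ∉ M, ∃ x ∈ E, z ∈ V x) ∧
      ∀ z ∉ M, ∃ P, IsOpen P ∧ z ∈ P ∧ ∃ b, P ∩ E ⊆ {b} := by
  have : ∀ x, ∃ n, x ∉ M → ∀ y ∈ M ∪ (V x)ᶜ, x ∉ g n y := fun x => by
    by_cases hx : x ∈ M
    · exact ⟨0, fun h => (h hx).elim⟩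
    · obtain ⟨n, hn⟩ := hg.sep' (hM.union (hVo x).isClosed_compl) (y := x)
        (by simp [hx, hV x])
      exact ⟨n, fun _ => hn⟩
  choose n hn using this
  -- Points are ordered by the index `n x` first and by a well-order second; `D` below selects
  -- greedily those points not covered by an earlier selected one.
  let f : X → ℕ × X := fun x => (n x, x)
  let r : X → X → Prop := InvImage (Prod.Lex (· < ·) (WellOrderingRel)) f
  have hwf : WellFounded r := InvImage.wf f (WellFounded.prod_lex wellFounded_lt
    WellOrderingRel.isWellOrder.wf)
  have htri : ∀ x y, r x y ∨ x = y ∨ r y x := fun x y => by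
    rcases trichotomous_of (Prod.Lex ((· < ·) : ℕ → ℕ → Prop) (WellOrderingRel)) (f x) (f y)
      with h | h | h
    · exact Or.inl h
    · exact Or.inr (Or.inl (congrArg Prod.snd h))
    · exact Or.inr (Or.inr h)
  have hrn : ∀ x y, r x y → n x ≤ n y := fun x y h => by
    rcases Prod.lex_def.1 h with h | h
    · exact h.le
    · exact h.1.le
  let D : X → Prop := hwf.fix fun x ih => x ∉ M ∧ ∀ y (h : r y x), ih y h → x ∉ V y
  have hD : ∀ x, D x ↔ x ∉ M ∧ ∀ y, r y x → D y → x ∉ V y := fun x => by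
    rw [show D x = _ from hwf.fix_eq _ x]
  have hcov : ∀ z ∉ M, ∃ x, D x ∧ z ∈ V x := fun z hz => by
    by_contra! h
    exact h z ((hD z).2 ⟨hz, fun y _ hy => h y hy⟩) (hV z)
  refine ⟨{x | D x}, Set.disjoint_left.2 fun x hx => ((hD x).1 hx).1, hcov, fun z hz => ?_⟩
  obtain ⟨b, ⟨hDb, hzb⟩, hmin⟩ := hwf.has_min {x | D x ∧ z ∈ V x} (hcov z hz)
  -- Selected points after `b` avoid `V b`. One before `b` has `z ∉ V x` and `n x ≤ n b`, so it
  -- avoids `g (n b) z`.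
  refine ⟨V b ∩ g (n b) z, (hVo b).inter (hg.isOpen _ _), ⟨hzb, hg.mem _ _⟩, b, ?_⟩
  rintro x ⟨⟨hxb, hxz⟩, hx⟩
  rcases htri x b with h | h | h
  · have hzx : z ∉ V x := fun hzx => hmin x ⟨hx, hzx⟩ h
    exact (hn x ((hD x).1 hx).1 z (Or.inr hzx) (hg.anti z (hrn x b h) hxz)).elim
  · exact h
  · exact (((hD x).1 hx).2 b h hDb hxb).elim

/-- A subset of `Mᶜ` which is closed and discrete in `Mᶜ` expands to open sets which are discrete
in `Mᶜ` and shrink towards `M`. -/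
theorem Stratification.exists_expansion (hg : Stratification g) {M E : Set X}
    (hM : IsClosed M) (hEM : Disjoint E M)
    (hE : ∀ z ∉ M, ∃ P, IsOpen P ∧ z ∈ P ∧ ∃ b, P ∩ E ⊆ {b}) [T1Space X] :
    ∃ N : X → Set X, (∀ x, IsOpen (N x)) ∧ (∀ x ∈ E, x ∈ N x) ∧
      ∀ z S, IsClosed S → z ∉ S →
        ∃ P, IsOpen P ∧ z ∈ P ∧ {x | x ∈ E ∩ S ∧ (P ∩ N x).Nonempty}.Finite := by
  have hcl : ∀ A ⊆ E, IsClosed (M ∪ A) := fun A hA => by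
    rw [← isOpen_compl_iff, isOpen_iff_forall_mem_open]
    intro z hz
    simp only [compl_union, mem_inter_iff, mem_compl_iff] at hz
    obtain ⟨P, hPo, hzP, b, hb⟩ := hE z hz.1
    by_cases hbz : b ∈ A
    · refine ⟨P ∩ Mᶜ ∩ {b}ᶜ, ?_, (hPo.inter hM.isOpen_compl).inter isOpen_compl_singleton,
        ⟨⟨hzP, hz.1⟩, fun h => hz.2 (by rw [mem_singleton_iff.1 h]; exact hbz)⟩⟩
      rintro w ⟨⟨hw, hwM⟩, hwb⟩ (h | h)
      · exact hwM h
      · exact hwb (hb ⟨hw, hA h⟩)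
    · refine ⟨P ∩ Mᶜ, ?_, hPo.inter hM.isOpen_compl, ⟨hzP, hz.1⟩⟩
      rintro w ⟨hw, hwM⟩ (h | h)
      · exact hwM h
      · exact hbz (by rw [← mem_singleton_iff.1 (hb ⟨hw, hA h⟩)]; exact h)
  have : ∀ x, ∃ n, x ∈ E → x ∉ closure (⋃ y ∈ M ∪ (E \ {x}), g n y) := fun x => by
    by_cases hx : x ∈ E
    · obtain ⟨n, hn⟩ := hg.sep _ (hcl (E \ {x}) sdiff_subset) x
        (by simp [Set.disjoint_left.1 hEM hx])
      exact ⟨n, fun _ => hn⟩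
    · exact ⟨0, fun h => (hx h).elim⟩
  choose n hn using this
  let N₀ : X → Set X := fun x => g (n x) x \ closure (⋃ y ∈ M ∪ (E \ {x}), g (n x) y)
  have hN₀o : ∀ x, IsOpen (N₀ x) := fun x => (hg.isOpen _ _).sdiff isClosed_closure
  have hdisj : ∀ x ∈ E, ∀ y ∈ E, n x ≤ n y → (N₀ x ∩ N₀ y).Nonempty → x = y := by
    rintro x hx y hy hxy ⟨w, hwx, hwy⟩
    by_contra hne
    exact hwx.2 (subset_closure (mem_biUnion (Or.inr ⟨hy, fun h => hne h.symm⟩)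
      (hg.anti y hxy hwy.1)))
  have hdisj' : ∀ x ∈ E, ∀ y ∈ E, (N₀ x ∩ N₀ y).Nonempty → x = y := fun x hx y hy h => by
    rcases le_total (n x) (n y) with hle | hle
    · exact hdisj x hx y hy hle h
    · exact (hdisj y hy x hx hle (by rwa [inter_comm])).symm
  -- The sets `N₀ x` are disjoint, so local finiteness can fail only at points of `C`; there a
  -- second shrinking, towards `C`, is used.
  let C : Set X := (⋃ x ∈ E, N₀ x)ᶜ
  have hC : IsClosed C := (isOpen_biUnion fun x _ => hN₀o x).isClosed_compl
  have hEC : ∀ x ∈ E, x ∉ C := fun x hx h => h (mem_biUnion hx ⟨hg.mem _ _, hn x hx⟩)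
  obtain ⟨Ω, hΩo, hΩ, -, hΩs⟩ := hg.exists_shrinking hC
  refine ⟨fun x => N₀ x ∩ Ω x, fun x => (hN₀o x).inter (hΩo x),
    fun x hx => ⟨⟨hg.mem _ _, hn x hx⟩, hΩ x (hEC x hx)⟩, fun z S hS hzS => ?_⟩
  by_cases hzC : z ∈ C
  · obtain ⟨P, hPo, hzP, hP⟩ := hΩs S hS z hzC hzS
    refine ⟨P, hPo, hzP, ?_⟩
    convert Set.finite_empty (α := X)
    refine eq_empty_of_forall_notMem fun x hx => ?_
    obtain ⟨w, hw, -, hw'⟩ := hx.2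
    exact Set.disjoint_left.1 (hP x hx.1.2) hw hw'
  · simp only [C, mem_compl_iff, not_not, mem_iUnion] at hzC
    obtain ⟨b, hb, hzb⟩ := hzC
    refine ⟨N₀ b, hN₀o b, hzb, (Set.finite_singleton b).subset ?_⟩
    rintro x ⟨⟨hx, -⟩, w, hw, hw', -⟩
    exact hdisj' x hx b hb ⟨w, hw', hw⟩

/-! ### Closure-preserving families and fattening -/

/-- An indexed family of closed sets which is closure-preserving, expressed locally. -/
def CPFam {Λ : Type*} (F : Λ → Set X) : Prop :=
  ∀ z, ∃ P, IsOpen P ∧ z ∈ P ∧ ∀ l, z ∉ F l → Disjoint P (F l)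

theorem CPFam.isClosed {Λ : Type*} {F : Λ → Set X} (hF : CPFam F) (l : Λ) : IsClosed (F l) := by
  rw [← isOpen_compl_iff, isOpen_iff_forall_mem_open]
  intro z hz
  obtain ⟨P, hPo, hzP, hP⟩ := hF z
  exact ⟨P, (hP l hz).subset_compl_right, hPo, hzP⟩

theorem CPFam.isClosed_iUnion {Λ : Type*} {F : Λ → Set X} (hF : CPFam F) (s : Set Λ) :
    IsClosed (⋃ l ∈ s, F l) := by
  rw [← isOpen_compl_iff, isOpen_iff_forall_mem_open]
  intro z hz
  obtain ⟨P, hPo, hzP, hP⟩ := hF z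
  refine ⟨P, fun w hw hw' => ?_, hPo, hzP⟩
  simp only [mem_iUnion] at hw'
  obtain ⟨l, hl, hwl⟩ := hw'
  exact Set.disjoint_left.1 (hP l fun h => hz (mem_biUnion hl h)) hw hwl

theorem CPFam.of_discrete {Λ : Type*} {H : Λ → Set X} (hHc : ∀ c, IsClosed (H c))
    (hH : ∀ z, ∃ P, IsOpen P ∧ z ∈ P ∧ ∃ b, ∀ c, (P ∩ H c).Nonempty → c = b) : CPFam H := by
  intro z
  obtain ⟨P, hPo, hzP, b, hb⟩ := hH z
  by_cases hz : z ∈ H b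
  · refine ⟨P, hPo, hzP, fun c hc => Set.disjoint_left.2 fun w hw hwc => hc ?_⟩
    rwa [hb c ⟨w, hw, hwc⟩]
  · refine ⟨P ∩ (H b)ᶜ, hPo.inter (hHc b).isOpen_compl, ⟨hzP, hz⟩, fun c _ =>
      Set.disjoint_left.2 fun w hw hwc => hw.2 ?_⟩
    rwa [← hb c ⟨w, hw.1, hwc⟩]

/-- Attaching to the members of a closure-preserving family members of closure-preserving families
located at some of their points. -/
theorem CPFam.attach {Λ ι : Type*} {F : Λ → Set X} (hF : CPFam F) {x : ι → X} {N : ι → Set X}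
    (hN : ∀ z S, IsClosed S → z ∉ S →
      ∃ P, IsOpen P ∧ z ∈ P ∧ {i | x i ∈ S ∧ (P ∩ N i).Nonempty}.Finite)
    {𝒦 : ι → Set (Set X)} (h𝒦 : ∀ i, CPFam fun K : 𝒦 i => (K : Set X))
    {K : ι → Λ → Set X} (hK : ∀ i l, x i ∈ F l → K i l ∈ 𝒦 i ∧ K i l ⊆ N i) :
    CPFam fun l => F l ∪ ⋃ i ∈ {i | x i ∈ F l}, K i l := by
  intro z
  obtain ⟨P₀, hP₀o, hzP₀, hP₀⟩ := hF z
  have hS := hF.isClosed_iUnion {l | z ∉ F l}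
  obtain ⟨P₁, hP₁o, hzP₁, hfin⟩ := hN z _ hS (by
    simp only [mem_iUnion, not_exists]
    exact fun l hl h => hl h)
  choose P hPo hzP hP using fun i => h𝒦 i z
  refine ⟨P₀ ∩ P₁ ∩ ⋂ i ∈ hfin.toFinset, P i, (hP₀o.inter hP₁o).inter
    (isOpen_biInter_finset fun i _ => hPo i), ⟨⟨hzP₀, hzP₁⟩, mem_iInter₂.2 fun i _ => hzP i⟩,
    fun l hl => ?_⟩
  simp only [mem_union, not_or, mem_iUnion, not_exists] at hl
  rw [Set.disjoint_left]
  rintro w ⟨⟨hw₀, hw₁⟩, hw⟩ (h | h)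
  · exact Set.disjoint_left.1 (hP₀ l hl.1) hw₀ h
  · simp only [mem_iUnion] at h
    obtain ⟨i, hi, hwi⟩ := h
    have hmem : i ∈ hfin.toFinset := by
      rw [Set.Finite.mem_toFinset]
      exact ⟨mem_biUnion (show l ∈ {l | z ∉ F l} from hl.1) hi, w, hw₁, (hK i l hi).2 hwi⟩
    exact Set.disjoint_left.1 (hP i ⟨K i l, (hK i l hi).1⟩ (hl.2 i hi))
      (mem_iInter₂.1 hw i hmem) hwi

/-- Enlarging a closure-preserving family of closed sets inside prescribed open sets, by attaching
small members of closure-preserving local networks at a dense set of points of `T`. -/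
theorem Stratification.exists_fattening [T1Space X] (hg : Stratification g) {Λ : Type*}
    {F : Λ → Set X} (hF : CPFam F) {O : Λ → Set X} (hO : ∀ l, IsOpen (O l))
    (hFO : ∀ l, F l ⊆ O l) {M T : Set X} (hM : IsClosed M) (hTM : Disjoint T M)
    (hT : IsClosed (T ∪ M)) {Ω : X → Set X} (hΩo : ∀ x ∈ T, IsOpen (Ω x))
    (hΩ : ∀ x ∈ T, x ∈ Ω x) {𝒦 : X → Set (Set X)}
    (h𝒦 : ∀ x ∈ T, CPFam fun K : 𝒦 x => (K : Set X)) (h𝒦n : ∀ x ∈ T, IsLocalNetwork x (𝒦 x)) :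
    ∃ 𝒮 : Λ → Set (Set X), CPFam (fun l => F l ∪ ⋃₀ 𝒮 l) ∧ ∀ l, ⋃₀ 𝒮 l ⊆ O l ∧
      (∀ K ∈ 𝒮 l, ∃ x ∈ F l ∩ T, K ∈ 𝒦 x ∧ K ⊆ Ω x) ∧
      F l ∩ T ⊆ closure {a | a ∈ F l ∩ T ∧ ∃ K ∈ 𝒮 l, K ∈ 𝒦 a} := by
  choose V hVo hV hVF using hF
  -- This factor forces a kernel point whose neighbourhood catches a point of `T` to lie in `T`
  -- itself.
  let Z : X → Set X := fun x => {z | x ∉ T ∪ M → z ∉ T ∪ M}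
  have hZo : ∀ x, IsOpen (Z x) := fun x => by
    by_cases hx : x ∈ T ∪ M
    · convert isOpen_univ (X := X)
      exact eq_univ_of_forall fun z h => (h hx).elim
    · convert hT.isOpen_compl
      exact Set.ext fun z => ⟨fun h => h hx, fun h _ => h⟩
  choose D hDM hDcov hDdisc using fun k => hg.exists_discrete_kernel hM
    (V := fun x => V x ∩ g k x ∩ Z x)
    (fun x => ((hVo x).inter (hg.isOpen k x)).inter (hZo x))
    (fun x => ⟨⟨hV x, hg.mem k x⟩, fun h => h⟩)
  choose N hNo hN hNfin using fun k => hg.exists_expansion hM (hDM k) (hDdisc k)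
  let ι := {i : ℕ × X // i.2 ∈ D i.1 ∧ i.2 ∈ T}
  let N' : ι → Set X := fun i => N i.1.1 i.1.2 ∩ g i.1.1 i.1.2 ∩ Ω i.1.2
  have hK : ∀ (i : ι) l, ∃ K, i.1.2 ∈ F l → K ∈ 𝒦 i.1.2 ∧ K ⊆ O l ∩ N' i := fun i l => by
    by_cases hi : i.1.2 ∈ F l
    · obtain ⟨K, hK, hKs⟩ := (h𝒦n i.1.2 i.2.2).exists_subset (O l ∩ N' i)
        ((hO l).inter (((hNo _ _).inter (hg.isOpen _ _)).inter (hΩo _ i.2.2)))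
        ⟨hFO l hi, ⟨hN _ _ i.2.1, hg.mem _ _⟩, hΩ _ i.2.2⟩
      exact ⟨K, fun _ => ⟨hK, hKs⟩⟩
    · exact ⟨∅, fun h => (hi h).elim⟩
  choose K hK using hK
  have hF : CPFam F := fun z => ⟨V z, hVo z, hV z, hVF z⟩
  have hatt := hF.attach (x := fun i : ι => i.1.2) (N := N') (𝒦 := fun i => 𝒦 i.1.2) (K := K) ?_
    (fun i => h𝒦 _ i.2.2) (fun i l hi => ⟨(hK i l hi).1, (hK i l hi).2.trans inter_subset_right⟩)
  · refine ⟨fun l => {A | ∃ i : ι, i.1.2 ∈ F l ∧ A = K i l}, ?_, fun l => ⟨?_, ?_, ?_⟩⟩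
    · convert hatt using 3 with l
      ext z
      simp only [mem_sUnion, mem_iUnion, mem_ofPred_eq]
      constructor
      · rintro ⟨_, ⟨i, hi, rfl⟩, hz⟩
        exact ⟨i, hi, hz⟩
      · rintro ⟨i, hi, hz⟩
        exact ⟨_, ⟨i, hi, rfl⟩, hz⟩
    · rintro z ⟨_, ⟨i, hi, rfl⟩, hz⟩
      exact ((hK i l hi).2 hz).1
    · rintro _ ⟨i, hi, rfl⟩
      exact ⟨i.1.2, ⟨hi, i.2.2⟩, (hK i l hi).1, fun z hz => ((hK i l hi).2 hz).2.2⟩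
    · rintro x ⟨hx, hxT⟩
      have hxM := Set.disjoint_left.1 hTM hxT
      rw [mem_closure_iff]
      intro U hU hxU
      obtain ⟨k, hk⟩ := hg.sep' hU.isClosed_compl (y := x) (by simpa using hxU)
      obtain ⟨d, hd, ⟨hxV, hxg⟩, hxZ⟩ := hDcov k x hxM
      -- `V d` misses every `F l` not containing `d`, so a kernel point catching `x ∈ F l` lies in
      -- `F l`. Kernel points of high level `k` are close to `x`, which gives density.
      have hdF : d ∈ F l := by
        by_contra h
        exact Set.disjoint_left.1 (hVF d l h) hxV hx
      have hdT : d ∈ T := by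
        by_contra h
        exact hxZ (fun hh => hh.elim h (Set.disjoint_left.1 (hDM k) hd)) (Or.inl hxT)
      refine ⟨d, ?_, ⟨hdF, hdT⟩, K ⟨(k, d), hd, hdT⟩ l, ⟨⟨(k, d), hd, hdT⟩, hdF, rfl⟩,
        (hK ⟨(k, d), hd, hdT⟩ l hdF).1⟩
      by_contra h
      exact hk d h hxg
  · intro z S hS hz
    -- Levels `k ≥ k₀` stay away from `z` because of the factor `g k x`; each of the finitely many
    -- lower levels contributes finitely many sets.
    obtain ⟨k₀, hk₀⟩ := hg.sep S hS z hz
    choose P hPo hzP hP using fun k => hNfin k z S hS hz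
    refine ⟨(closure (⋃ x ∈ S, g k₀ x))ᶜ ∩ ⋂ k ∈ Finset.range k₀, P k,
      isClosed_closure.isOpen_compl.inter (isOpen_biInter_finset fun k _ => hPo k),
      ⟨hk₀, mem_iInter₂.2 fun k _ => hzP k⟩, ?_⟩
    refine Set.Finite.of_finite_image (f := fun i : ι => i.1) ?_ Subtype.val_injective.injOn
    refine ((Finset.range k₀).finite_toSet.biUnion
      fun k _ => (hP k).image (fun x => (k, x))).subset ?_
    rintro _ ⟨i, ⟨hiS, w, ⟨hw₀, hw⟩, ⟨hwN, hwg⟩, -⟩, rfl⟩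
    have hlt : i.1.1 < k₀ := by
      by_contra! h
      exact hw₀ (subset_closure (mem_biUnion hiS (hg.anti _ h hwg)))
    exact mem_biUnion (by simpa using hlt)
      ⟨i.1.2, ⟨⟨i.2.1, hiS⟩, w, mem_iInter₂.1 hw _ (by simpa using hlt), hwN⟩, rfl⟩

/-! ### Discrete closed covers and transitive neighbourhoods -/

/-- Every neighbourhood assignment is controlled by a `σ`-discrete closed cover. -/
theorem Stratification.exists_discrete_cover (hg : Stratification g) {V : X → Set X}
    (hVo : ∀ x, IsOpen (V x)) (hV : ∀ x, x ∈ V x) :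
    ∃ H : ℕ → X → Set X, (∀ n c, IsClosed (H n c)) ∧ (∀ x, ∃ n c, x ∈ H n c) ∧
      (∀ n z, ∃ P, IsOpen P ∧ z ∈ P ∧ ∃ b, ∀ c, (P ∩ H n c).Nonempty → c = b) ∧
      ∀ n c, ∀ z ∈ H n c, z ∈ V c ∧ ∃ w ∈ V z ∩ H n c, c ∈ V w := by
  -- For `x ∈ Y n`, `x ∈ g n y` implies `y ∈ V x`; this reverses the relation and yields the last
  -- claim.
  let Y : ℕ → Set X := fun n => {x | ∀ y ∈ (V x)ᶜ, x ∉ g n y}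
  let W : ℕ → X → Set X := fun n x => V x ∩ g n x
  have hWo : ∀ n x, IsOpen (W n x) := fun n x => (hVo x).inter (hg.isOpen n x)
  have hW : ∀ n x, x ∈ W n x := fun n x => ⟨hV x, hg.mem n x⟩
  have hwf : WellFounded (WellOrderingRel : X → X → Prop) := WellOrderingRel.isWellOrder.wf
  let A : ℕ → ℕ → X → Set X := fun n m c =>
    {y | y ∈ Y n ∧ y ∈ W n c ∧ c ∈ Y n ∧ (∀ d ∈ Y n, WellOrderingRel d c → y ∉ W n d) ∧
      ∀ z ∈ (W n c)ᶜ, y ∉ g m z}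
  have hcl : ∀ n m c, ∀ z ∈ closure (A n m c), z ∈ W n c := fun n m c z hz => by
    by_contra h
    obtain ⟨w, hw, hwA⟩ := mem_closure_iff.1 hz (g m z) (hg.isOpen m z) (hg.mem m z)
    exact hwA.2.2.2.2 z h hw
  refine ⟨fun k c => closure (A k.unpair.1 k.unpair.2 c), fun _ _ => isClosed_closure, fun x => ?_,
    fun k z => ?_, fun k c z hz => ?_⟩
  · obtain ⟨n, hn⟩ := hg.sep' (hVo x).isClosed_compl (y := x) (by simpa using hV x)
    obtain ⟨c, ⟨hc, hxc⟩, hmin⟩ := hwf.has_min {c | c ∈ Y n ∧ x ∈ W n c} ⟨x, hn, hW n x⟩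
    obtain ⟨m, hm⟩ := hg.sep' (hWo n c).isClosed_compl (y := x) (by simpa using hxc)
    refine ⟨Nat.pair n m, c, subset_closure ?_⟩
    rw [Nat.unpair_pair]
    exact ⟨hn, hxc, hc, fun d hd hdc hxd => hmin d ⟨hd, hxd⟩ hdc, hm⟩
  · dsimp only
    generalize k.unpair.1 = n
    generalize k.unpair.2 = m
    by_cases hz : ∃ b, b ∈ Y n ∧ z ∈ W n b
    · obtain ⟨b, ⟨hb, hzb⟩, hmin⟩ := hwf.has_min {c | c ∈ Y n ∧ z ∈ W n c} hz
      refine ⟨W n b ∩ g m z, (hWo n b).inter (hg.isOpen m z), ⟨hzb, hg.mem m z⟩, b, fun c hc => ?_⟩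
      rw [inter_comm, closure_inter_open_nonempty_iff ((hWo n b).inter (hg.isOpen m z))] at hc
      obtain ⟨w, ⟨hwY, hwc, hcY, hwmin, hwm⟩, hwb, hwz⟩ := hc
      rcases trichotomous_of (WellOrderingRel : X → X → Prop) c b with h | h | h
      · exact (hwm z (fun hzc => hmin c ⟨hcY, hzc⟩ h) hwz).elim
      · exact h
      · exact (hwmin b hb h hwb).elim
    · refine ⟨g m z, hg.isOpen m z, hg.mem m z, z, fun c hc => ?_⟩
      rw [inter_comm, closure_inter_open_nonempty_iff (hg.isOpen m z)] at hc
      obtain ⟨w, ⟨hwY, hwc, hcY, hwmin, hwm⟩, hwz⟩ := hc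
      exact (hwm z (fun hzc => hz ⟨c, hcY, hzc⟩) hwz).elim
  · refine ⟨(hcl _ _ c z hz).1, ?_⟩
    obtain ⟨w, hw, hwA⟩ := mem_closure_iff.1 hz (V z) (hVo z) (hV z)
    refine ⟨w, ⟨hw, subset_closure hwA⟩, ?_⟩
    by_contra h
    exact hwA.1 c h hwA.2.1.2

/-- Discrete families of closed sets in a stratifiable space expand to disjoint open sets. -/
theorem Stratification.exists_disjoint_expansion (hg : Stratification g) {H : X → Set X}
    (hHc : ∀ c, IsClosed (H c))
    (hH : ∀ z, ∃ P, IsOpen P ∧ z ∈ P ∧ ∃ b, ∀ c, (P ∩ H c).Nonempty → c = b) :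
    ∃ G : X → Set X, (∀ c, IsOpen (G c)) ∧ (∀ c, H c ⊆ G c) ∧
      ∀ c d, (G c ∩ G d).Nonempty → c = d := by
  have hcl : ∀ s : Set X, IsClosed (⋃ c ∈ s, H c) :=
    (CPFam.of_discrete hHc hH).isClosed_iUnion
  have : ∀ c x, ∃ n, x ∈ H c → x ∉ closure (⋃ y ∈ ⋃ d ∈ ({c}ᶜ : Set X), H d, g n y) := by
    intro c x
    by_cases hx : x ∈ H c
    · obtain ⟨n, hn⟩ := hg.sep _ (hcl {c}ᶜ) x (by
        simp only [mem_iUnion, not_exists]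
        intro d hdc hxd
        obtain ⟨P, -, hxP, b, hb⟩ := hH x
        exact hdc ((hb d ⟨x, hxP, hxd⟩).trans (hb c ⟨x, hxP, hx⟩).symm))
      exact ⟨n, fun _ => hn⟩
    · exact ⟨0, fun h => (hx h).elim⟩
  choose n hn using this
  let N : X → X → Set X := fun c x =>
    g (n c x) x \ closure (⋃ y ∈ ⋃ d ∈ ({c}ᶜ : Set X), H d, g (n c x) y)
  have key : ∀ c d x y, x ∈ H c → y ∈ H d → n c x ≤ n d y → (N c x ∩ N d y).Nonempty → c = d := by
    rintro c d x y hx hy hle ⟨w, hwx, hwy⟩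
    by_contra hne
    exact hwx.2 (subset_closure (mem_biUnion (mem_biUnion (show d ∈ ({c}ᶜ : Set X) from
      fun h => hne h.symm) hy) (hg.anti y hle hwy.1)))
  refine ⟨fun c => ⋃ x ∈ H c, N c x,
    fun c => isOpen_biUnion fun x _ => (hg.isOpen _ _).sdiff isClosed_closure,
    fun c x hx => mem_biUnion hx ⟨hg.mem _ _, hn c x hx⟩, fun c d => ?_⟩
  rintro ⟨w, hwc, hwd⟩
  simp only [mem_iUnion] at hwc hwd
  obtain ⟨x, hx, hwx⟩ := hwc
  obtain ⟨y, hy, hwy⟩ := hwd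
  rcases le_total (n c x) (n d y) with h | h
  · exact key c d x y hx hy h ⟨w, hwx, hwy⟩
  · exact (key d c y x hy hx h ⟨w, hwy, hwx⟩).symm

/-- Every neighbourhood assignment `V` of a stratifiable space has a transitive neighbourhood
assignment inside its third iterate. -/
theorem Stratification.exists_transitive (hg : Stratification g) {V : X → Set X}
    (hVo : ∀ x, IsOpen (V x)) (hV : ∀ x, x ∈ V x) :
    ∃ W : X → Set X, (∀ x, IsOpen (W x)) ∧ (∀ x, x ∈ W x) ∧ (∀ x, ∀ y ∈ W x, W y ⊆ W x) ∧
      ∀ x, ∀ z ∈ W x, ∃ w ∈ V x, ∃ c ∈ V w, z ∈ V c := by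
  obtain ⟨H, hHc, hcov, hdisc, hHV⟩ := hg.exists_discrete_cover hVo hV
  choose G hGo hHG hGd using fun n => hg.exists_disjoint_expansion (hHc n) (hdisc n)
  have hLc : ∀ n, IsClosed (⋃ c, H n c) := fun n => by
    simpa using (CPFam.of_discrete (hHc n) (hdisc n)).isClosed_iUnion univ
  -- Removing the earlier layers leaves each point in `U k c` for only finitely many `k`, and
  -- disjointness of the `G k c` allows one `c` per `k`; hence the `W x` below are open.
  let U : ℕ → X → Set X := fun k c => (G k c ∩ V c) \ ⋃ j ∈ Finset.range k, ⋃ c, H j c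
  have hUo : ∀ k c, IsOpen (U k c) := fun k c => ((hGo k c).inter (hVo c)).sdiff
    ((Finset.range k).finite_toSet.isClosed_biUnion fun j _ => hLc j)
  let W : X → Set X := fun x => {z | ∀ k c, x ∈ U k c → z ∈ U k c}
  refine ⟨W, fun x => ?_, fun x k c h => h, fun x y hy z hz k c h => hz k c (hy k c h),
    fun x z hz => ?_⟩
  · obtain ⟨n, c₀, hx⟩ := hcov x
    have hle : ∀ k c, x ∈ U k c → k < n + 1 := fun k c h => by
      by_contra! hk
      exact h.2 (mem_biUnion (show n ∈ Finset.range k by simp; omega) (mem_iUnion.2 ⟨c₀, hx⟩))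
    have : W x = ⋂ k ∈ Finset.range (n + 1), {z | ∀ c, x ∈ U k c → z ∈ U k c} := by
      ext z
      simp only [W, mem_ofPred_eq, mem_iInter, Finset.mem_range]
      exact ⟨fun h k _ c hc => h k c hc, fun h k c hc => h k (hle k c hc) c hc⟩
    rw [this]
    refine isOpen_biInter_finset fun k _ => ?_
    by_cases h : ∃ c, x ∈ U k c
    · obtain ⟨c, hc⟩ := h
      convert hUo k c using 1
      ext z
      refine ⟨fun h => h c hc, fun h d hd => ?_⟩
      rwa [← hGd k c d ⟨x, hc.1.1, hd.1.1⟩]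
    · convert isOpen_univ (X := X)
      ext z
      simp only [mem_ofPred_eq, mem_univ, iff_true]
      exact fun c hc => (h ⟨c, hc⟩).elim
  · classical
    have hex : ∃ n c, x ∈ H n c := hcov x
    obtain ⟨c, hxc⟩ := Nat.find_spec hex
    obtain ⟨hxV, w, hw, hcw⟩ := hHV _ c x hxc
    refine ⟨w, hw.1, c, hcw, (hz (Nat.find hex) c ⟨⟨hHG _ c hxc, hxV⟩, ?_⟩).1.2⟩
    simp only [mem_iUnion, not_exists]
    intro j hj d hxd
    exact Nat.find_min hex (by simpa using hj) ⟨d, hxd⟩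

/-- Transitive neighbourhoods of the points off a closed set `M` which shrink towards `M`. -/
theorem Stratification.exists_transitive_shrinking (hg : Stratification g) {M : Set X}
    (hM : IsClosed M) :
    ∃ W : X → Set X, (∀ x, IsOpen (W x)) ∧ (∀ x, x ∈ W x) ∧ (∀ x, ∀ y ∈ W x, W y ⊆ W x) ∧
      (∀ x ∉ M, Disjoint (W x) M) ∧
      ∀ S, IsClosed S → ∀ z ∈ M, z ∉ S →
        ∃ P, IsOpen P ∧ z ∈ P ∧ ∀ x ∈ S \ M, Disjoint P (W x) := by
  classical
  obtain ⟨Ω, hΩo, hΩ, hΩM, hΩs⟩ := hg.exists_shrinking hM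
  obtain ⟨W, hWo, hW, hWt, hWV⟩ := hg.exists_transitive (V := fun x => if x ∈ M then univ else Ω x)
    (fun x => by split_ifs; exacts [isOpen_univ, hΩo x])
    (fun x => by by_cases hx : x ∈ M <;> simp [hx, hΩ])
  have hmem : ∀ x ∉ M, ∀ z ∈ W x, ∃ w ∈ Ω x \ M, ∃ c ∈ Ω w \ M, z ∈ Ω c \ M := by
    intro x hx z hz
    obtain ⟨w, hw, c, hc, hz⟩ := hWV x z hz
    rw [if_neg hx] at hw
    have hwM := Set.disjoint_left.1 (hΩM x) hw
    rw [if_neg hwM] at hc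
    have hcM := Set.disjoint_left.1 (hΩM w) hc
    rw [if_neg hcM] at hz
    exact ⟨w, ⟨hw, hwM⟩, c, ⟨hc, hcM⟩, hz, Set.disjoint_left.1 (hΩM c) hz⟩
  refine ⟨W, hWo, hW, hWt, fun x hx => ?_, fun S hS z hz hzS => ?_⟩
  · rw [Set.disjoint_left]
    intro z hz
    obtain ⟨w, -, c, -, hz⟩ := hmem x hx z hz
    exact hz.2
  -- One shrinking for each of the three links joining `x` to a point of `W x`.
  · obtain ⟨P₁, hP₁o, hzP₁, hP₁⟩ := hΩs S hS z hz hzS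
    obtain ⟨P₂, hP₂o, hzP₂, hP₂⟩ := hΩs P₁ᶜ hP₁o.isClosed_compl z hz (by simpa using hzP₁)
    obtain ⟨P₃, hP₃o, hzP₃, hP₃⟩ := hΩs P₂ᶜ hP₂o.isClosed_compl z hz (by simpa using hzP₂)
    refine ⟨P₃, hP₃o, hzP₃, fun x hx => ?_⟩
    rw [Set.disjoint_right]
    intro y hy
    obtain ⟨w, hw, c, hc, hy⟩ := hmem x hx.2 y hy
    exact Set.disjoint_right.1 (hP₃ c (Set.disjoint_right.1
      (hP₂ w (Set.disjoint_right.1 (hP₁ x hx.1) hw.1)) hc.1)) hy.1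

/-- Every closed subset of a stratifiable space has a closure-preserving base of closed
neighbourhoods. -/
theorem Stratification.exists_cpFam_closed_nhds (hg : Stratification g) {M : Set X}
    (hM : IsClosed M) :
    ∃ K : {O : Set X // IsOpen O ∧ M ⊆ O} → Set X, CPFam K ∧ ∀ O, M ⊆ interior (K O) ∧
      K O ⊆ O := by
  obtain ⟨W, hWo, hW, hWt, hWM, hWs⟩ := hg.exists_transitive_shrinking hM
  -- By transitivity, `z ∉ K O` gives `W z` disjoint from `K O`, so one neighbourhood of `z` serves
  -- all `O`.
  refine ⟨fun O => (⋃ x ∈ (O : Set X)ᶜ, W x)ᶜ, fun z => ?_, fun O => ⟨fun z hz => ?_, ?_⟩⟩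
  · by_cases hz : z ∈ M
    · refine ⟨univ, isOpen_univ, mem_univ _, fun O h => (h ?_).elim⟩
      simp only [mem_compl_iff, mem_iUnion, not_exists]
      exact fun x hx hzx => Set.disjoint_left.1 (hWM x fun h => hx (O.2.2 h)) hzx hz
    · refine ⟨W z, hWo z, hW z, fun O h => ?_⟩
      simp only [mem_compl_iff, not_not, mem_iUnion] at h
      obtain ⟨x, hx, hzx⟩ := h
      rw [disjoint_compl_right_iff_subset]
      exact (hWt x z hzx).trans (subset_biUnion_of_mem (u := W) hx)
  · obtain ⟨P, hPo, hzP, hP⟩ := hWs (O : Set X)ᶜ O.2.1.isClosed_compl z hz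
      (fun h => h (O.2.2 hz))
    refine mem_interior.2 ⟨P, fun w hw hw' => ?_, hPo, hzP⟩
    simp only [mem_iUnion] at hw'
    obtain ⟨x, hx, hwx⟩ := hw'
    exact Set.disjoint_left.1 (hP x ⟨hx, fun h => hx (O.2.2 h)⟩) hw hwx
  · rw [compl_subset_comm]
    exact fun x hx => mem_biUnion hx (hW x)

/-! ### Good points, the δ-hull and property (δ) -/

/-- `p` has a closure-preserving local network consisting of closed sets from `𝒞`. -/
def GoodAt (𝒞 : Set (Set X)) (p : X) : Prop :=
  ∃ 𝒦 ⊆ 𝒞, CPFam (fun K : 𝒦 => (K : Set X)) ∧ IsLocalNetwork p 𝒦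

theorem CPFam.range {Λ : Type*} {F : Λ → Set X} (hF : CPFam F) :
    CPFam fun K : Set.range F => (K : Set X) := fun z => by
  obtain ⟨P, hPo, hzP, hP⟩ := hF z
  refine ⟨P, hPo, hzP, ?_⟩
  rintro ⟨_, l, rfl⟩ h
  exact hP l h

theorem CPFam.closurePreserving {𝒦 : Set (Set X)} (h : CPFam fun K : 𝒦 => (K : Set X)) :
    ClosurePreserving 𝒦 := by
  intro 𝒱 h𝒱
  have hcl : ∀ V ∈ 𝒱, closure V = V := fun V hV => (h.isClosed ⟨V, h𝒱 hV⟩).closure_eq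
  rw [iUnion₂_congr hcl]
  refine IsClosed.closure_eq ?_
  rw [← isOpen_compl_iff, isOpen_iff_forall_mem_open]
  intro z hz
  obtain ⟨P, hPo, hzP, hP⟩ := h z
  refine ⟨P, fun w hw hw' => ?_, hPo, hzP⟩
  simp only [mem_iUnion] at hw'
  obtain ⟨V, hV, hwV⟩ := hw'
  exact Set.disjoint_left.1 (hP ⟨V, h𝒱 hV⟩ fun h => hz (mem_biUnion hV h)) hw hwV

/-- Since `B` is closed off `p`, fattening applies with `M = {p}` and `T = B`. The attached sets are
dense enough to absorb the trace on `B`, whose closure contains `p`. -/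
theorem GoodAt.of_mem_deltaHull [T1Space X] (hg : Stratification g) {𝒞 : Set (Set X)}
    (h𝒞 : ∀ 𝒮 ⊆ 𝒞, closure (⋃₀ 𝒮) ∈ 𝒞) {A : Set X} (hA : ∀ q ∈ A, GoodAt 𝒞 q) {p : X}
    (hp : p ∈ deltaHull A) : GoodAt 𝒞 p := by
  obtain ⟨B, hBA, hB⟩ := hp
  by_cases hpB : p ∈ B
  · exact hA p (hBA hpB)
  have hBc : IsClosed (B ∪ {p}) := hB ▸ isClosed_closure
  obtain ⟨K, hK, hKO⟩ := hg.exists_cpFam_closed_nhds (isClosed_singleton (x := p))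
  have hF : CPFam fun O => K O ∩ (B ∪ {p}) := fun z => by
    by_cases hz : z ∈ B ∪ {p}
    · obtain ⟨P, hPo, hzP, hP⟩ := hK z
      exact ⟨P, hPo, hzP, fun O hO => (hP O fun h => hO ⟨h, hz⟩).mono_right inter_subset_left⟩
    · exact ⟨(B ∪ {p})ᶜ, hBc.isOpen_compl, hz, fun O _ =>
        disjoint_compl_left.mono_right inter_subset_right⟩
  have : ∀ x, ∃ 𝒦 : Set (Set X), x ∈ B → 𝒦 ⊆ 𝒞 ∧ CPFam (fun K : 𝒦 => (K : Set X)) ∧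
      IsLocalNetwork x 𝒦 := fun x => by
    by_cases hx : x ∈ B
    · obtain ⟨𝒦, h⟩ := hA x (hBA hx)
      exact ⟨𝒦, fun _ => h⟩
    · exact ⟨∅, fun h => (hx h).elim⟩
  choose 𝒦 h𝒦 using this
  obtain ⟨𝒮, hcp, h𝒮⟩ := hg.exists_fattening hF (fun O => O.2.1)
    (fun O => inter_subset_left.trans (hKO O).2) isClosed_singleton
    (disjoint_singleton_right.2 hpB) hBc (Ω := fun _ => univ) (fun _ _ => isOpen_univ)
    (fun _ _ => mem_univ _) (fun x hx => (h𝒦 x hx).2.1) (fun x hx => (h𝒦 x hx).2.2)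
  refine ⟨_, ?_, hcp.range, ⟨?_, fun U hU hpU => ?_⟩⟩
  · rintro _ ⟨O, rfl⟩
    obtain ⟨-, h𝒮₁, h𝒮₂⟩ := h𝒮 O
    convert h𝒞 (𝒮 O) fun L hL => ?_
    · refine Subset.antisymm (union_subset ?_ subset_closure)
        (closure_minimal subset_union_right (hcp.isClosed O))
      have hsub : K O ∩ (B ∪ {p}) ∩ B ⊆ closure (⋃₀ 𝒮 O) := h𝒮₂.trans (closure_mono (by
        rintro a ⟨⟨-, haB⟩, L, hL, hLa⟩
        exact ⟨L, hL, (h𝒦 a haB).2.2.mem L hLa⟩))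
      rintro z ⟨hzK, hzB | rfl⟩
      · exact hsub ⟨⟨hzK, Or.inl hzB⟩, hzB⟩
      · refine closure_minimal hsub isClosed_closure ?_
        have hzB : z ∈ closure B := by rw [hB]; simp
        rw [mem_closure_iff]
        intro U hU hzU
        obtain ⟨w, ⟨hwU, hwK⟩, hwB⟩ := mem_closure_iff.1 hzB (U ∩ interior (K O))
          (hU.inter isOpen_interior) ⟨hzU, (hKO O).1 rfl⟩
        exact ⟨w, hwU, ⟨interior_subset hwK, Or.inl hwB⟩, hwB⟩
    · obtain ⟨x, hx, hLx, -⟩ := h𝒮₁ L hL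
      exact (h𝒦 x hx.2).1 hLx
  · rintro _ ⟨O, rfl⟩
    exact Or.inl ⟨interior_subset ((hKO O).1 rfl), Or.inr rfl⟩
  · refine ⟨_, ⟨⟨U, hU, singleton_subset_iff.2 hpU⟩, rfl⟩, union_subset ?_ (h𝒮 _).1⟩
    exact inter_subset_left.trans (hKO _).2

theorem GoodAt.of_mem_deltaIter [T1Space X] (hg : Stratification g) {𝒞 : Set (Set X)}
    (h𝒞 : ∀ 𝒮 ⊆ 𝒞, closure (⋃₀ 𝒮) ∈ 𝒞) {A : Set X} (hA : ∀ q ∈ A, GoodAt 𝒞 q)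
    (α : Ordinal.{u}) : ∀ p ∈ deltaIter A α, GoodAt 𝒞 p := by
  induction α using Ordinal.limitRecOn with
  | zero => rwa [deltaIter_zero]
  | add_one α ih =>
    rw [← Order.succ_eq_add_one, deltaIter_succ]
    exact fun p => GoodAt.of_mem_deltaHull hg h𝒞 ih
  | limit α hα ih =>
    rw [deltaIter_limit A α hα]
    intro p hp
    simp only [mem_iUnion] at hp
    obtain ⟨β, hβ, hp⟩ := hp
    exact ih β hβ p hp

theorem GoodAt.of_dense [T1Space X] (hg : Stratification g) (hX : HasDeltaOrder X)
    {𝒞 : Set (Set X)} (h𝒞 : ∀ 𝒮 ⊆ 𝒞, closure (⋃₀ 𝒮) ∈ 𝒞) {A : Set X} (hAd : Dense A)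
    (hA : ∀ q ∈ A, GoodAt 𝒞 q) (p : X) : GoodAt 𝒞 p := by
  obtain ⟨α, hα⟩ := hX
  exact GoodAt.of_mem_deltaIter hg h𝒞 hA α p (hα.1 A ▸ hAd p)

theorem closure_sUnion_mem_of_monotone {σ : Set X → Set X} (hσ : Monotone σ)
    (hσs : ∀ B, σ B ⊆ B) {𝒮 : Set (Set X)} (h : 𝒮 ⊆ {B | B = closure (σ B)}) :
    closure (⋃₀ 𝒮) ∈ {B | B = closure (σ B)} := by
  refine Subset.antisymm (closure_minimal (sUnion_subset fun B hB => ?_) isClosed_closure)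
    (closure_minimal (hσs _) isClosed_closure)
  exact (h hB).subset.trans <| closure_mono (hσ ((subset_sUnion_of_mem hB).trans subset_closure))

/-- In a stratifiable space with the `δ`-order, every point has a closure-preserving local network
of closed sets in which a given closed nowhere dense set is negligible. -/
theorem goodAt_of_isNowhereDense [T1Space X] (hg : Stratification g) (hX : HasDeltaOrder X)
    {M : Set X} (hM : IsClosed M) (hMn : IsNowhereDense M) (p : X) :
    GoodAt {B | B = closure (B \ M)} p := by
  refine GoodAt.of_dense hg hX (fun 𝒮 h => closure_sUnion_mem_of_monotone (σ := fun B => B \ M)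
    (fun _ _ h => sdiff_subset_sdiff_left h) (fun _ => sdiff_subset) h)
    (A := Mᶜ) ?_ (fun q hq => ⟨{{q}}, ?_, ?_, ⟨?_, ?_⟩⟩) p
  · rw [← interior_eq_empty_iff_dense_compl]
    rwa [IsNowhereDense, hM.closure_eq] at hMn
  · rintro _ rfl
    have : ({q} : Set X) \ M = {q} := by simpa using hq
    simp [this]
  · intro z
    by_cases hz : z = q
    · refine ⟨univ, isOpen_univ, mem_univ _, ?_⟩
      rintro ⟨_, rfl⟩ h
      exact (h hz).elim
    · refine ⟨{q}ᶜ, isOpen_compl_singleton, hz, ?_⟩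
      rintro ⟨_, rfl⟩ _
      exact disjoint_compl_left
  · rintro _ rfl
    rfl
  · exact fun U _ hU => ⟨_, rfl, singleton_subset_iff.2 hU⟩

theorem HasDeltaOrder.propertyDelta [T1Space X] (hg : Stratification g) (hX : HasDeltaOrder X) :
    PropertyDelta X := by
  intro M hM hMn p _
  obtain ⟨ℬ, hℬ, hcp, hnet⟩ := goodAt_of_isNowhereDense hg hX hM hMn p
  exact ⟨ℬ, fun B hB => hcp.isClosed ⟨B, hB⟩, hcp.closurePreserving, hnet, fun B hB => hℬ hB⟩

/-! ### Regular closed networks and the class `𝒫` -/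

theorem closure_sUnion_mem_regularClosed {𝒮 : Set (Set X)}
    (h : 𝒮 ⊆ {B | B = closure (interior B)}) :
    closure (⋃₀ 𝒮) ∈ {B : Set X | B = closure (interior B)} :=
  closure_sUnion_mem_of_monotone (fun _ _ => interior_mono) (fun _ => interior_subset) h

/-- A decreasing sequence of closed sets is CP at `z` as soon as one looks outside the first member
missing `z`. -/
theorem goodAt_of_isCountablyGenerated [T1Space X] [RegularSpace X] {p : X}
    (h : (𝓝 p).IsCountablyGenerated) : GoodAt {B | B = closure (interior B)} p := by
  obtain ⟨s, hs⟩ := (𝓝 p).exists_antitone_basis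
  let R : ℕ → Set X := fun n => closure (interior (s n))
  have hR : ∀ U, IsOpen U → p ∈ U → ∃ n, R n ⊆ U := fun U hU hp => by
    obtain ⟨C, hC, hCc, hCU⟩ := exists_mem_nhds_isClosed_subset (hU.mem_nhds hp)
    obtain ⟨n, hn⟩ := hs.mem_iff.1 hC
    exact ⟨n, (closure_minimal (interior_subset.trans hn) hCc).trans hCU⟩
  have hanti : Antitone R := fun m n h => closure_mono (interior_mono (hs.antitone h))
  have hp : ∀ n, p ∈ R n := fun n =>
    subset_closure (mem_interior_iff_mem_nhds.2 (hs.1.mem_of_mem trivial))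
  refine ⟨Set.range R, ?_, CPFam.range fun z => ?_, ⟨?_, fun U hU hp => ?_⟩⟩
  · rintro _ ⟨n, rfl⟩
    exact Subset.antisymm (closure_mono (interior_maximal subset_closure isOpen_interior))
      (closure_minimal interior_subset isClosed_closure)
  · by_cases hz : z = p
    · exact ⟨univ, isOpen_univ, mem_univ _, fun n h => (h (hz ▸ hp n)).elim⟩
    · classical
      obtain ⟨n, hn⟩ := hR {z}ᶜ isOpen_compl_singleton (fun h => hz h.symm)
      have hex : ∃ n, z ∉ R n := ⟨n, fun h => hn h rfl⟩
      refine ⟨(R (Nat.find hex))ᶜ, isClosed_closure.isOpen_compl, Nat.find_spec hex, fun m hm => ?_⟩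
      exact disjoint_compl_left.mono_right (hanti (Nat.find_min' hex hm))
  · rintro _ ⟨n, rfl⟩
    exact hp n
  · obtain ⟨n, hn⟩ := hR U hU hp
    exact ⟨_, ⟨n, rfl⟩, hn⟩

/-- In a stratifiable space the points without countable neighbourhood base lie in the union of an
increasing sequence of closed nowhere dense sets. -/
theorem Stratification.exists_nowhereDense_cover (hg : Stratification g) :
    ∃ M : ℕ → Set X, Monotone M ∧ (∀ n, IsClosed (M n)) ∧ (∀ n, interior (M n) = ∅) ∧
      M 0 = ∅ ∧ ∀ y ∉ ⋃ n, M n, (𝓝 y).IsCountablyGenerated := by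
  choose H hHc hcov hdisc hHV using fun n =>
    hg.exists_discrete_cover (V := g n) (hg.isOpen n) (hg.mem n)
  have hLc : ∀ n k, IsClosed (⋃ c, H n k c) := fun n k => by
    simpa using (CPFam.of_discrete (hHc n k) (hdisc n k)).isClosed_iUnion univ
  -- A point off all these frontiers is, for each `n`, interior to some layer, and discreteness
  -- leaves a single piece of it nearby. Such pieces become the countable base.
  let f : ℕ → Set X := fun j => frontier (⋃ c, H j.unpair.1 j.unpair.2 c)
  have hfc : ∀ n, IsClosed (⋃ j ∈ Finset.range n, f j) := fun n =>
    (Finset.range n).finite_toSet.isClosed_biUnion fun j _ => isClosed_frontier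
  refine ⟨fun n => ⋃ j ∈ Finset.range n, f j, fun m n h => ?_, hfc, fun n => ?_, by simp,
    fun y hy => ?_⟩
  · refine biUnion_subset_biUnion_left fun j hj => ?_
    simp only [SetLike.mem_coe, Finset.mem_range] at hj ⊢
    omega
  · induction n with
    | zero => simp
    | succ n ih =>
      dsimp only at ih ⊢
      rw [Finset.range_add_one, Finset.set_biUnion_insert,
        interior_union_isClosed_of_interior_empty isClosed_frontier ih]
      exact interior_frontier (hLc _ _)
  · have hA : ∀ n, ∃ A ∈ 𝓝 y, ∃ c, ∀ z ∈ A, (z ∈ g n c ∧ y ∈ g n c) ∧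
        ∃ w ∈ g n z, c ∈ g n w := fun n => by
      obtain ⟨k, c, hyc⟩ := hcov n y
      have hyL : y ∈ interior (⋃ c, H n k c) := by
        by_contra h
        refine hy (mem_iUnion.2 ⟨Nat.pair n k + 1, mem_biUnion
          (show Nat.pair n k ∈ Finset.range (Nat.pair n k + 1) by simp) ?_⟩)
        simp only [f, Nat.unpair_pair]
        exact ⟨subset_closure (mem_iUnion.2 ⟨c, hyc⟩), h⟩
      obtain ⟨P, hPo, hyP, b, hb⟩ := hdisc n k y
      refine ⟨interior (⋃ c, H n k c) ∩ P, (isOpen_interior.inter hPo).mem_nhds ⟨hyL, hyP⟩, c,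
        fun z hz => ?_⟩
      obtain ⟨d, hzd⟩ := mem_iUnion.1 (interior_subset hz.1)
      have hdc : d = c := (hb d ⟨z, hz.2, hzd⟩).trans (hb c ⟨y, hyP, hyc⟩).symm
      subst hdc
      obtain ⟨hzV, w, hw, hcw⟩ := hHV n k d z hzd
      exact ⟨⟨hzV, (hHV n k d y hyc).1⟩, w, hw.1, hcw⟩
    choose A hAy c hAc using hA
    have hsub : ∀ U, IsOpen U → y ∈ U → ∃ n, A n ⊆ U := fun U hU hyU => by
      have step : ∀ U, IsOpen U → y ∈ U → ∃ n, ∃ U', IsOpen U' ∧ y ∈ U' ∧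
          ∀ m ≥ n, ∀ x, (g m x ∩ U').Nonempty → x ∈ U := fun U hU hyU => by
        obtain ⟨n, hn⟩ := hg.sep Uᶜ hU.isClosed_compl y (by simpa using hyU)
        refine ⟨n, _, isClosed_closure.isOpen_compl, hn, fun m hm x ⟨w, hwx, hw⟩ => ?_⟩
        by_contra hx
        exact hw (subset_closure (mem_biUnion (show x ∈ Uᶜ from hx) (hg.anti x hm hwx)))
      obtain ⟨n₁, U₁, hU₁, hyU₁, h₁⟩ := step U hU hyU
      obtain ⟨n₂, U₂, hU₂, hyU₂, h₂⟩ := step U₁ hU₁ hyU₁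
      obtain ⟨n₃, U₃, hU₃, hyU₃, h₃⟩ := step U₂ hU₂ hyU₂
      refine ⟨max n₁ (max n₂ n₃), fun z hz => ?_⟩
      obtain ⟨⟨-, hyc⟩, w, hw, hcw⟩ := hAc _ z hz
      have hcU := h₃ _ (le_max_of_le_right (le_max_right _ _)) _ ⟨y, hyc, hyU₃⟩
      have hwU := h₂ _ (le_max_of_le_right (le_max_left _ _)) _ ⟨_, hcw, hcU⟩
      exact h₁ _ (le_max_left _ _) _ ⟨w, hw, hwU⟩
    have hbasis : (𝓝 y).HasBasis (fun _ : ℕ => True) A := ⟨fun t => by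
      rw [mem_nhds_iff]
      constructor
      · rintro ⟨U, hUt, hU, hyU⟩
        obtain ⟨n, hn⟩ := hsub U hU hyU
        exact ⟨n, trivial, hn.trans hUt⟩
      · rintro ⟨n, -, hn⟩
        exact mem_nhds_iff.1 (mem_of_superset (hAy n) hn)⟩
    exact hbasis.isCountablyGenerated

/-- A closure-preserving family can be enlarged so that its members become regular closed at the
points of a closed nowhere dense set `M'`, if they are already so at the points of `M`. -/
theorem Stratification.exists_enlargement [T1Space X] (hg : Stratification g) {Λ : Type*}
    {F O : Λ → Set X} (hF : CPFam F) (hO : ∀ l, IsOpen (O l)) (hFO : ∀ l, F l ⊆ O l)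
    {M M' : Set X} (hM : IsClosed M) (hM' : IsClosed M') (hMM' : M ⊆ M')
    (hM'i : interior M' = ∅) (hδ : ∀ p, GoodAt {B | B = closure (B \ M')} p)
    (hFM : ∀ l, F l ∩ M ⊆ closure (interior (F l))) {Ω : X → Set X}
    (hΩo : ∀ x, IsOpen (Ω x)) (hΩ : ∀ x, x ∈ Ω x) (hΩt : ∀ x, ∀ y ∈ Ω x, Ω y ⊆ Ω x) :
    ∃ F' : Λ → Set X, CPFam F' ∧ ∀ l, F l ⊆ F' l ∧ F' l ⊆ O l ∧
      F' l ∩ M' ⊆ closure (interior (F' l)) ∧ F' l ⊆ F l ∪ ⋃ x ∈ F l \ M, Ω x := by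
  choose 𝒦 h𝒦s h𝒦 h𝒦n using hδ
  obtain ⟨𝒮, hcp, h𝒮⟩ := hg.exists_fattening hF hO hFO hM (T := M' \ M) disjoint_sdiff_left
    (by rwa [sdiff_union_of_subset hMM']) (fun x _ => hΩo x) (fun x _ => hΩ x)
    (fun x _ => h𝒦 x) (fun x _ => h𝒦n x)
  have hGO : ∀ l, F l ∪ ⋃₀ 𝒮 l ⊆ O l := fun l => union_subset (hFO l) (h𝒮 l).1
  have hKG : ∀ l, ∀ K ∈ 𝒮 l, K ⊆ closure ((F l ∪ ⋃₀ 𝒮 l) \ M') := fun l K hK => by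
    obtain ⟨x, -, hKx, -⟩ := (h𝒮 l).2.1 K hK
    refine (h𝒦s x hKx).subset.trans (closure_mono (sdiff_subset_sdiff_left ?_))
    exact (subset_sUnion_of_mem hK).trans subset_union_right
  have hG : ∀ l, (F l ∪ ⋃₀ 𝒮 l) ∩ M' ⊆ closure ((F l ∪ ⋃₀ 𝒮 l) \ M') := by
    rintro l z ⟨hz | ⟨K, hK, hz⟩, hzM'⟩
    · by_cases hzM : z ∈ M
      · refine closure_minimal ?_ isClosed_closure (hFM l ⟨hz, hzM⟩)
        refine ((interior_eq_empty_iff_dense_compl.1 hM'i).open_subset_closure_inter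
          isOpen_interior).trans (closure_mono fun w hw => ⟨Or.inl (interior_subset hw.1), hw.2⟩)
      · refine closure_minimal ?_ isClosed_closure ((h𝒮 l).2.2 ⟨hz, hzM', hzM⟩)
        rintro a ⟨-, K, hK, hKa⟩
        exact hKG l K hK ((h𝒦n a).mem K hKa)
    · exact hKG l K hK hz
  choose N hN hNO using fun x : X => hg.exists_cpFam_closed_nhds (isClosed_singleton (x := x))
  -- The first fattening made the sets accumulate at `M'` from outside `M'`; now closed
  -- neighbourhoods are attached at those outside points, without adding points of `M'`.
  obtain ⟨𝒯, hcp', h𝒯⟩ := hg.exists_fattening hcp hO hGO hM' (T := M'ᶜ) disjoint_compl_left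
    (by simp) (Ω := fun x => Ω x ∩ M'ᶜ) (fun x _ => (hΩo x).inter hM'.isOpen_compl)
    (fun x hx => ⟨hΩ x, hx⟩) (𝒦 := fun x => Set.range (N x)) (fun x _ => (hN x).range)
    (fun x _ => ⟨by rintro _ ⟨U, rfl⟩; exact interior_subset ((hNO x U).1 rfl), fun U hU hx =>
      ⟨_, ⟨⟨U, hU, singleton_subset_iff.2 hx⟩, rfl⟩, (hNO x _).2⟩⟩)
  refine ⟨_, hcp', fun l => ⟨subset_union_left.trans subset_union_left,
    union_subset (hGO l) (h𝒯 l).1, ?_, ?_⟩⟩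
  · rintro z ⟨hz | ⟨K, hK, hz⟩, hzM'⟩
    · refine closure_minimal ((h𝒯 l).2.2.trans (closure_minimal ?_ isClosed_closure))
        isClosed_closure (hG l ⟨hz, hzM'⟩)
      rintro a ⟨-, K, hK, U, rfl⟩
      exact subset_closure (interior_mono ((subset_sUnion_of_mem hK).trans subset_union_right)
        ((hNO a U).1 rfl))
    · obtain ⟨x, -, -, hKx⟩ := (h𝒯 l).2.1 K hK
      exact ((hKx hz).2 hzM').elim
  · have hsub : F l ∪ ⋃₀ 𝒮 l ⊆ F l ∪ ⋃ x ∈ F l \ M, Ω x := by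
      refine union_subset_union_right _ (sUnion_subset fun K hK => ?_)
      obtain ⟨x, hx, -, hKx⟩ := (h𝒮 l).2.1 K hK
      exact hKx.trans (subset_biUnion_of_mem (u := Ω) (show x ∈ F l \ M from ⟨hx.1, hx.2.2⟩))
    refine union_subset hsub (sUnion_subset fun K hK => ?_)
    obtain ⟨x, hx, -, hKx⟩ := (h𝒯 l).2.1 K hK
    refine (hKx.trans inter_subset_left).trans ?_
    rcases hsub hx.1 with h | h
    · exact (subset_biUnion_of_mem (u := Ω)
        (show x ∈ F l \ M from ⟨h, fun hxM => hx.2 (hMM' hxM)⟩)).trans subset_union_right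
    · simp only [mem_iUnion] at h
      obtain ⟨y, hy, hxy⟩ := h
      exact (hΩt y x hxy).trans
        ((subset_biUnion_of_mem (u := Ω) hy).trans subset_union_right)

/-- Points of an open set covered by countably many closed nowhere dense sets have
closure-preserving local networks of regular closed sets. -/
theorem Stratification.goodAt_of_subset_iUnion [T1Space X] [RegularSpace X]
    (hg : Stratification g) {M : ℕ → Set X} (hMm : Monotone M) (hM : ∀ n, IsClosed (M n))
    (hMi : ∀ n, interior (M n) = ∅) (hM0 : M 0 = ∅)
    (hδ : ∀ n p, GoodAt {B | B = closure (B \ M n)} p) {U : Set X} (hU : IsOpen U)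
    (hUM : U ⊆ ⋃ n, M n) {p : X} (hp : p ∈ U) : GoodAt {B | B = closure (interior B)} p := by
  obtain ⟨C, hC, hCc, hCU⟩ := exists_mem_nhds_isClosed_subset (hU.mem_nhds hp)
  choose W hWo hW hWt _ hWs using fun n => hg.exists_transitive_shrinking (hM n)
  -- Additions at stage `n` obey the shrinkings towards all of `M 0, ..., M n` at once.
  let Ω : ℕ → X → Set X := fun n x => ⋂ j ∈ Finset.range (n + 1), W j x
  have hΩW : ∀ n j x, j ≤ n → Ω n x ⊆ W j x := fun n j x h =>
    biInter_subset_of_mem (show j ∈ Finset.range (n + 1) by simp; omega)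
  let Λ := {O : Set X // IsOpen O ∧ p ∈ O ∧ O ⊆ C}
  let St : ℕ → Type u := fun n => {F : Λ → Set X // CPFam F ∧ (∀ l, F l ⊆ l) ∧
    ∀ l, F l ∩ M n ⊆ closure (interior (F l))}
  have hstep : ∀ n (F : St n), ∃ F' : St (n + 1), ∀ l, F.1 l ⊆ F'.1 l ∧
      F'.1 l ⊆ F.1 l ∪ ⋃ x ∈ F.1 l \ M n, Ω n x := by
    rintro n ⟨F, hF, hFO, hFM⟩
    obtain ⟨F', hF', h⟩ := hg.exists_enlargement hF (O := fun l : Λ => (l : Set X)) (fun l => l.2.1)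
      hFO (hM n) (hM (n + 1)) (hMm n.le_succ) (hMi _) (hδ _) hFM (Ω := Ω n)
      (fun x => isOpen_biInter_finset fun j _ => hWo j x) (fun x => mem_iInter₂.2 fun j _ => hW j x)
      (fun x y hy => iInter₂_mono fun j hj => hWt j x y (mem_iInter₂.1 hy j hj))
    exact ⟨⟨F', hF', fun l => (h l).2.1, fun l => (h l).2.2.1⟩, fun l => ⟨(h l).1, (h l).2.2.2⟩⟩
  choose next hnext using hstep
  let F₀ : St 0 := ⟨fun _ => {p}, fun z => by
      by_cases hz : z = p
      · exact ⟨univ, isOpen_univ, mem_univ _, fun _ h => (h hz).elim⟩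
      · exact ⟨{p}ᶜ, isOpen_compl_singleton, hz, fun _ _ => disjoint_compl_left⟩,
    fun l => singleton_subset_iff.2 l.2.2.1, fun l => by simp [hM0]⟩
  let S : ∀ n, St n := fun n => Nat.rec F₀ next n
  have hmono : ∀ l, Monotone fun n => (S n).1 l := fun l =>
    monotone_nat_of_le_succ fun n => (hnext n (S n) l).1
  have hctrl : ∀ l n m, n ≤ m → (S m).1 l ⊆ (S n).1 l ∪ ⋃ x ∈ (S n).1 l \ M n, W n x := by
    intro l n m hnm
    induction m, hnm using Nat.le_induction with
    | base => exact subset_union_left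
    | succ m hnm ih =>
      refine (hnext m (S m) l).2.trans (union_subset ih (iUnion₂_subset fun x hx => ?_))
      refine (hΩW m n x hnm).trans ?_
      rcases ih hx.1 with h | h
      · exact (subset_biUnion_of_mem (u := W n) (show x ∈ (S n).1 l \ M n from
          ⟨h, fun hxM => hx.2 (hMm hnm hxM)⟩)).trans subset_union_right
      · simp only [mem_iUnion] at h
        obtain ⟨y, hy, hxy⟩ := h
        exact (hWt n y x hxy).trans
          ((subset_biUnion_of_mem (u := W n) hy).trans subset_union_right)
  have hcp : CPFam fun l => ⋃ n, (S n).1 l := by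
    intro z
    by_cases hz : z ∈ C
    · obtain ⟨n, hn⟩ := mem_iUnion.1 (hUM (hCU hz))
      have hcl := (S n).2.1.isClosed_iUnion {l | z ∉ (S n).1 l}
      have hzcl : z ∉ ⋃ l ∈ {l | z ∉ (S n).1 l}, (S n).1 l := by
        simp only [mem_iUnion, not_exists]
        exact fun l hl h => hl h
      -- Here `z ∈ M n`. By `hctrl`, a member whose stage `n` misses `z` grows later only inside `W
      -- n x` with `x` in that stage and off `M n`, hence away from `P`.
      obtain ⟨P, hPo, hzP, hP⟩ := hWs n _ hcl z hn hzcl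
      refine ⟨P ∩ (⋃ l ∈ {l | z ∉ (S n).1 l}, (S n).1 l)ᶜ, hPo.inter hcl.isOpen_compl,
        ⟨hzP, hzcl⟩, fun l hl => Set.disjoint_left.2 fun w hw hwl => ?_⟩
      have hzl : z ∉ (S n).1 l := fun h => hl (mem_iUnion.2 ⟨n, h⟩)
      obtain ⟨m, hm⟩ := mem_iUnion.1 hwl
      rcases hctrl l n (max n m) (le_max_left _ _) (hmono l (le_max_right n m) hm) with h | h
      · exact hw.2 (mem_biUnion (show l ∈ {l | z ∉ (S n).1 l} from hzl) h)
      · simp only [mem_iUnion] at h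
        obtain ⟨x, hx, hwx⟩ := h
        exact Set.disjoint_left.1 (hP x ⟨mem_biUnion (show l ∈ {l | z ∉ (S n).1 l} from hzl) hx.1,
          hx.2⟩) hw.1 hwx
    · exact ⟨Cᶜ, hCc.isOpen_compl, hz, fun l _ => disjoint_compl_left.mono_right
        (iUnion_subset fun n => ((S n).2.2.1 l).trans l.2.2.2)⟩
  refine ⟨_, ?_, hcp.range, ⟨?_, fun V hV hpV => ?_⟩⟩
  · rintro _ ⟨l, rfl⟩
    refine Subset.antisymm (iUnion_subset fun n z hz => ?_)
      (closure_minimal interior_subset (hcp.isClosed l))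
    obtain ⟨k, hk⟩ := mem_iUnion.1 (hUM (hCU (l.2.2.2 ((S n).2.2.1 l hz))))
    exact closure_mono (interior_mono (subset_iUnion (fun n => (S n).1 l) (max n k)))
      ((S (max n k)).2.2.2 l ⟨hmono l (le_max_left n k) hz, hMm (le_max_right n k) hk⟩)
  · rintro _ ⟨l, rfl⟩
    exact mem_iUnion.2 ⟨0, rfl⟩
  · refine ⟨_, ⟨⟨V ∩ interior C, hV.inter isOpen_interior, ⟨hpV, mem_interior_iff_mem_nhds.2 hC⟩,
      inter_subset_right.trans interior_subset⟩, rfl⟩, ?_⟩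
    exact iUnion_subset fun n => ((S n).2.2.1 _).trans inter_subset_left

theorem goodAt_regularClosed [T1Space X] [RegularSpace X] (hg : Stratification g)
    (hX : HasDeltaOrder X) (p : X) : GoodAt {B | B = closure (interior B)} p := by
  obtain ⟨M, hMm, hM, hMi, hM0, hcount⟩ := hg.exists_nowhereDense_cover
  refine GoodAt.of_dense hg hX (fun 𝒮 h => closure_sUnion_mem_regularClosed h)
    (A := {q | GoodAt {B | B = closure (interior B)} q}) ?_ (fun _ h => h) p
  rw [dense_iff_inter_open]
  rintro U hU ⟨q, hq⟩
  by_contra hne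
  have hbad : ∀ y ∈ U, ¬ GoodAt {B | B = closure (interior B)} y := fun y hy h => hne ⟨y, hy, h⟩
  refine hbad q hq (hg.goodAt_of_subset_iUnion hMm hM hMi hM0 (fun n => goodAt_of_isNowhereDense hg
    hX (hM n) ((hM n).isNowhereDense_iff.2 (hMi n))) hU (fun y hy => ?_) hq)
  by_contra h
  exact hbad y hy (goodAt_of_isCountablyGenerated (hcount y h))

/-- Fattening with `M = ∅` and `T = univ` gives a CP family of regular closed neighbourhoods `R O`.
Interiors remain CP because each `R O` is the closure of its interior. -/
theorem Stratification.exists_openNhdBase [T1Space X] (hg : Stratification g)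
    (hX : ∀ p : X, GoodAt {B | B = closure (interior B)} p) {F : Set X} (hF : IsClosed F) :
    ∃ 𝒰 : Set (Set X), IsOpenNhdBase F 𝒰 ∧ ClosurePreserving 𝒰 := by
  obtain ⟨K, hK, hKO⟩ := hg.exists_cpFam_closed_nhds hF
  choose 𝒦 h𝒦s h𝒦 h𝒦n using hX
  obtain ⟨𝒮, hcp, h𝒮⟩ := hg.exists_fattening hK (fun O => O.2.1) (fun O => (hKO O).2)
    isClosed_empty (T := univ) disjoint_bot_right (by simp) (Ω := fun _ => univ)
    (fun _ _ => isOpen_univ) (fun _ _ => mem_univ _) (fun x _ => h𝒦 x) (fun x _ => h𝒦n x)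
  let R : {O : Set X // IsOpen O ∧ F ⊆ O} → Set X := fun O => K O ∪ ⋃₀ 𝒮 O
  have hSR : ∀ O, ⋃₀ 𝒮 O ⊆ closure (interior (R O)) := fun O => sUnion_subset fun L hL => by
    obtain ⟨x, -, hLx, -⟩ := (h𝒮 O).2.1 L hL
    exact (h𝒦s x hLx).subset.trans (closure_mono (interior_mono
      ((subset_sUnion_of_mem hL).trans subset_union_right)))
  have hR : ∀ O, R O ⊆ closure (interior (R O)) := fun O => by
    refine union_subset (fun z hz => ?_) (hSR O)
    refine closure_minimal ?_ isClosed_closure ((h𝒮 O).2.2 ⟨hz, mem_univ z⟩)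
    rintro a ⟨-, L, hL, hLa⟩
    exact hSR O ⟨L, hL, (h𝒦n a).mem L hLa⟩
  refine ⟨Set.range fun O => interior (R O), ⟨?_, ?_, fun O hO hFO => ?_⟩, ?_⟩
  · rintro _ ⟨O, rfl⟩
    exact isOpen_interior
  · rintro _ ⟨O, rfl⟩
    exact (hKO O).1.trans (interior_mono subset_union_left)
  · exact ⟨_, ⟨⟨O, hO, hFO⟩, rfl⟩, interior_subset.trans (union_subset (hKO _).2 (h𝒮 _).1)⟩
  · intro 𝒱 h𝒱
    refine Subset.antisymm ?_ (iUnion₂_subset fun V hV => closure_mono (subset_biUnion_of_mem (u := id) hV))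
    have hcl := hcp.isClosed_iUnion {O | interior (R O) ∈ 𝒱}
    refine (closure_minimal ?_ hcl).trans ?_
    · refine iUnion₂_subset fun V hV => ?_
      obtain ⟨O, rfl⟩ := h𝒱 hV
      exact interior_subset.trans (subset_biUnion_of_mem (u := R)
        (show O ∈ {O | interior (R O) ∈ 𝒱} from hV))
    · exact iUnion₂_subset fun O hO => (hR O).trans (subset_biUnion_of_mem
        (u := fun V : Set X => closure V) hO)

/-! ### The δ-order of sequential spaces -/

theorem subset_deltaHull [T1Space X] (A : Set X) : A ⊆ deltaHull A := fun p hp =>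
  ⟨{p}, singleton_subset_iff.2 hp, by simp⟩

theorem deltaHull_subset_closure (A : Set X) : deltaHull A ⊆ closure A := by
  rintro p ⟨B, hBA, hB⟩
  exact closure_mono hBA (by rw [hB]; simp)

theorem deltaIter_subset_closure (A : Set X) (α : Ordinal.{u}) : deltaIter A α ⊆ closure A := by
  induction α using Ordinal.limitRecOn with
  | zero => rw [deltaIter_zero]; exact subset_closure
  | add_one α ih =>
    rw [← Order.succ_eq_add_one, deltaIter_succ]
    exact (deltaHull_subset_closure _).trans (closure_minimal ih isClosed_closure)
  | limit α hα ih =>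
    rw [deltaIter_limit A α hα]
    exact iUnion₂_subset ih

theorem deltaIter_mono [T1Space X] (A : Set X) : Monotone (deltaIter A) := by
  intro α β h
  induction β using Ordinal.limitRecOn with
  | zero => rw [nonpos_iff_eq_zero.1 h]
  | add_one β ih =>
    rcases h.eq_or_lt with rfl | h
    · exact le_rfl
    · rw [← Order.succ_eq_add_one] at h ⊢
      rw [deltaIter_succ]
      exact (ih (Order.lt_succ_iff.1 h)).trans (subset_deltaHull _)
  | limit β hβ ih =>
    rcases h.eq_or_lt with rfl | h
    · exact le_rfl
    · rw [deltaIter_limit A β hβ]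
      exact subset_biUnion_of_mem (u := deltaIter A) h

theorem mem_deltaHull_of_tendsto [T2Space X] {A : Set X} {x : ℕ → X} {p : X}
    (hx : ∀ n, x n ∈ A) (hp : Tendsto x atTop (𝓝 p)) : p ∈ deltaHull A := by
  refine ⟨Set.range x, Set.range_subset_iff.2 hx, ?_⟩
  refine Subset.antisymm ?_ (union_subset subset_closure ?_)
  · refine closure_minimal subset_union_left ?_
    rw [union_singleton]
    exact hp.isCompact_insert_range.isClosed
  · exact singleton_subset_iff.2 (mem_closure_of_tendsto hp (Eventually.of_forall fun n => ⟨n, rfl⟩))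

/-- Otherwise the iterates would embed all ordinals of the universe into `Set X`. -/
theorem exists_deltaIter_eq_deltaHull [T1Space X] (A : Set X) :
    ∃ α, deltaHull (deltaIter A α) = deltaIter A α := by
  by_contra! h
  have hs : StrictMono (deltaIter A) := by
    refine (deltaIter_mono A).strictMono_of_injective fun α β hαβ => ?_
    by_contra hne
    wlog hlt : α < β generalizing α β
    · exact this β α hαβ.symm (Ne.symm hne) (lt_of_le_of_ne (not_lt.1 hlt) (Ne.symm hne))
    refine h α (Subset.antisymm ?_ (subset_deltaHull _))
    rw [← deltaIter_succ]
    exact (deltaIter_mono A (Order.succ_le_of_lt hlt)).trans hαβ.symm.subset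
  exact not_injective_of_ordinal (deltaIter A) hs.injective

theorem SequentialSpace.hasDeltaOrder [T2Space X] [SequentialSpace X] : HasDeltaOrder X := by
  choose α hα using fun A : Set X => exists_deltaIter_eq_deltaHull A
  have hcl : ∀ A, closure A = deltaIter A (α A) := fun A => by
    refine Subset.antisymm (closure_minimal ?_ ?_) (deltaIter_subset_closure A _)
    · have := deltaIter_mono A (zero_le (a := α A))
      rwa [deltaIter_zero] at this
    · refine IsSeqClosed.isClosed fun x p hx hp => ?_
      rw [← hα A]
      exact mem_deltaHull_of_tendsto hx hp
  have hne : {β : Ordinal.{u} | ∀ A : Set X, closure A = deltaIter A β}.Nonempty := by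
    -- The stabilization index depends on `A`; the supremum over the small type `Set X` serves all
    -- sets.
    refine ⟨⨆ A, α A, fun A => Subset.antisymm ?_ (deltaIter_subset_closure A _)⟩
    rw [hcl A]
    exact deltaIter_mono A (Ordinal.le_iSup α A)
  exact ⟨sInf _, csInf_mem hne, fun β hβ => csInf_le' hβ⟩

end

end M3Problem

theorem mainTheorem4 (X : Type u) [TopologicalSpace X] [T1Space X] [RegularSpace X]
    (hM3 : M3Problem.IsM3Space X) :
    (M3Problem.HasDeltaOrder X → M3Problem.PropertyDelta X ∧ M3Problem.InClassP X) ∧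
    (SequentialSpace X → M3Problem.PropertyDelta X ∧ M3Problem.InClassP X) := by
  obtain ⟨g, hg⟩ := hM3.exists_stratification
  have key : M3Problem.HasDeltaOrder X → M3Problem.PropertyDelta X ∧ M3Problem.InClassP X :=
    fun hX => ⟨hX.propertyDelta hg, hM3, fun F hF =>
      hg.exists_openNhdBase (M3Problem.goodAt_regularClosed hg hX) hF⟩
  refine ⟨key, fun hseq => key ?_⟩
  have : T3Space X := {}
  exact M3Problem.SequentialSpace.hasDeltaOrder
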